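/- Let $E$ be a real or complex Banach space, let $(e^{tD})_{t\in\mathbb R}$ be a strongly continuous one-parameter group of linear isometries of $E$ ($\|e^{tD}f\|=\|f\|$), and let $D$ be its infinitesimal generator, $Df=\lim_{t\to0}t^{-1}(e^{tD}f-f)$, with domain the set of $f$ for which the limit exists; the powers $D^k$ have their natural domains. For $\sigma\ge 0$ let $$\mathbf B_\sigma(D)=\Big\{f\in\bigcap_{k\in\mathbb N}\mathcal D(D^k):\ \|D^kf\|\le\sigma^k\|f\|\ \text{for all }k\in\mathbb N\Big\}.$$ For $\sigma>0$ and $m\in\mathbb N=\{1,2,\dots\}$ let $\mathcal B_D^{(r)}(\sigma)$ be the bounded operators on $E$ given by the absolutely convergent series $$\mathcal B_D^{(2m-1)}(\sigma)f=\Big(\frac{\sigma}{\pi}\Big)^{2m-1}\sum_{k\in\mathbb Z}(-1)^{k+1}A_{m,k}\,e^{\frac{\pi}{\sigma}(k-\frac12)D}f,\qquad \mathcal B_D^{(2m)}(\sigma)f=\Big(\frac{\sigma}{\pi}\Big)^{2m}\sum_{k\in\mathbb Z}(-1)^{k+1}B_{m,k}\,e^{\frac{\pi k}{\sigma}D}f,$$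 where $$A_{m,k}=\frac{(2m-1)!}{\pi(k-\frac12)^{2m}}\sum_{j=0}^{m-1}\frac{(-1)^j}{(2j)!}\Big(\pi\big(k-\tfrac12\big)\Big)^{2j}\quad(k\in\mathbb Z),$$ $$B_{m,k}=\frac{(2m)!}{\pi k^{2m+1}}\sum_{j=0}^{m-1}\frac{(-1)^j(\pi k)^{2j+1}}{(2j+1)!}\quad(k\in\mathbb Z\setminus\{0\}),\qquad B_{m,0}=(-1)^{m+1}\frac{\pi^{2m}}{2m+1}.$$ Then: 1. For every $\sigma\ge0$, $\mathbf B_\sigma(D)$ is a closed linear subspace of $E$. 2. If $\sigma\ge0$, $f\in\mathbf B_\sigma(D)$, and $\sigma_1,\sigma_2>0$ satisfy $\sigma_1\ge\sigma$ and $\sigma_2\ge\sigma$, then $\mathcal B_D^{(r)}(\sigma_1)f=\mathcal B_D^{(r)}(\sigma_2)f$ for every $r\in\mathbb N$. 3. If $\sigma>0$ and $f\in\mathbf B_\sigma(D)$, then $D^rf=\mathcal B_D^{(r)}(\sigma)f=\big(\mathcal B_D^{(1)}(\sigma)\big)^rf$ for every $r\in\mathbb N$, where $\big(\mathcal B_D^{(1)}(\sigma)\big)^r$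 is the $r$-fold composition. -/

import Mathlib

open Filter Topology

noncomputable section

/-! ### Partially defined operators: composition and powers -/

section PartialOperators

variable {𝕜 E : Type*} [Ring 𝕜] [AddCommGroup E] [Module 𝕜 E]

/-- Composition `A ∘ B` of partially defined operators, on its natural domain
`{x ∈ dom B | B x ∈ dom A}`. -/
def opComp (A B : E →ₗ.[𝕜] E) : E →ₗ.[𝕜] E where
  domain :=
    { carrier := {x | ∃ hx : x ∈ B.domain, B ⟨x, hx⟩ ∈ A.domain}
      add_mem' := by
        rintro x y ⟨hx, hx'⟩ ⟨hy, hy'⟩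
        refine ⟨B.domain.add_mem hx hy, ?_⟩
        have h : B ⟨x + y, B.domain.add_mem hx hy⟩ = B ⟨x, hx⟩ + B ⟨y, hy⟩ :=
          B.map_add ⟨x, hx⟩ ⟨y, hy⟩
        rw [h]
        exact A.domain.add_mem hx' hy'
      zero_mem' := by
        refine ⟨B.domain.zero_mem, ?_⟩
        have h : B ⟨0, B.domain.zero_mem⟩ = 0 := B.map_zero
        rw [h]
        exact A.domain.zero_mem
      smul_mem' := by
        rintro c x ⟨hx, hx'⟩
        refine ⟨B.domain.smul_mem c hx, ?_⟩
        have h : B ⟨c • x, B.domain.smul_mem c hx⟩ = c • B ⟨x, hx⟩ :=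
          B.toFun.map_smul c ⟨x, hx⟩
        rw [h]
        exact A.domain.smul_mem c hx' }
  toFun :=
    { toFun := fun x => A ⟨B ⟨x.1, x.2.choose⟩, x.2.choose_spec⟩
      map_add' := by
        intro x y
        rw [← A.map_add]
        congr 1
        apply Subtype.ext
        exact B.map_add ⟨x.1, x.2.choose⟩ ⟨y.1, y.2.choose⟩
      map_smul' := by
        intro c x
        refine Eq.trans ?_ (A.toFun.map_smul c ⟨B ⟨x.1, x.2.choose⟩, x.2.choose_spec⟩)
        refine congrArg A.toFun ?_
        apply Subtype.ext
        exact B.toFun.map_smul c ⟨x.1, x.2.choose⟩ }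

/-- Powers of a partially defined operator: `D ^ 0` is the identity of `E` and
`D ^ (k + 1) = D ∘ D ^ k`, each on its natural domain. -/
def opPow (D : E →ₗ.[𝕜] E) : ℕ → (E →ₗ.[𝕜] E)
  | 0 => (LinearMap.id : E →ₗ[𝕜] E).toPMap ⊤
  | k + 1 => opComp D (opPow D k)

end PartialOperators

section BernsteinVectors

variable {𝕜 E : Type*} [RCLike 𝕜] [NormedAddCommGroup E] [NormedSpace 𝕜 E]

/-- The Bernstein set `𝐁_σ(D)`: the vectors `f` that lie in the domain of every power of `D` and
satisfy `‖D ^ k f‖ ≤ σ ^ k ‖f‖` for all `k`. -/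
def bernsteinSet (D : E →ₗ.[𝕜] E) (σ : ℝ) : Set E :=
  {f | ∀ k : ℕ, ∃ hf : f ∈ (opPow D k).domain, ‖opPow D k ⟨f, hf⟩‖ ≤ σ ^ k * ‖f‖}

end BernsteinVectors

/-! ### One-parameter groups of isometries and their generators -/

/-- A strongly continuous one-parameter group of linear isometries of `E`. -/
structure IsometryGroup (𝕜 E : Type*) [RCLike 𝕜] [NormedAddCommGroup E] [NormedSpace 𝕜 E] where
  /-- the operator `e ^ (t D)` -/
  op : ℝ → E →L[𝕜] E
  op_zero : op 0 = ContinuousLinearMap.id 𝕜 E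
  op_add : ∀ s t : ℝ, op (s + t) = (op s).comp (op t)
  strongly_continuous : ∀ f : E, Continuous fun t : ℝ => op t f
  norm_op : ∀ (t : ℝ) (f : E), ‖op t f‖ = ‖f‖

namespace IsometryGroup

variable {𝕜 E : Type*} [RCLike 𝕜] [NormedAddCommGroup E] [NormedSpace 𝕜 E]

/-- The graph of the generator: the pairs `(f, g)` with `(e ^ (t D) f - f) / t → g` as `t → 0`. -/
def generatorGraph (U : IsometryGroup 𝕜 E) : Submodule 𝕜 (E × E) where
  carrier := {p | Tendsto (fun t : ℝ => ((t⁻¹ : ℝ) : 𝕜) • (U.op t p.1 - p.1)) (𝓝[≠] 0) (𝓝 p.2)}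
  add_mem' := by
    intro p q hp hq
    refine (Tendsto.add hp hq).congr fun t => ?_
    simp only [Prod.fst_add, map_add, ← smul_add]
    congr 1
    abel
  zero_mem' := by simp
  smul_mem' := by
    intro c p hp
    refine (Tendsto.const_smul hp c).congr fun t => ?_
    simp only [Prod.smul_fst, map_smul]
    rw [smul_comm, smul_sub]

/-- The infinitesimal generator `D` of the group. -/
def generator (U : IsometryGroup 𝕜 E) : E →ₗ.[𝕜] E :=
  U.generatorGraph.toLinearPMap

/-- `f ∈ dom D` and `D f = g` if and only if `(e ^ (t D) f - f) / t → g` as `t → 0`. -/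
theorem mem_graph_generator (U : IsometryGroup 𝕜 E) (f g : E) :
    (f, g) ∈ U.generator.graph ↔
      Tendsto (fun t : ℝ => ((t⁻¹ : ℝ) : 𝕜) • (U.op t f - f)) (𝓝[≠] 0) (𝓝 g) := by
  have h : ∀ x ∈ U.generatorGraph, x.1 = 0 → x.2 = 0 := by
    rintro ⟨x, y⟩ hxy hx
    simp only at hx
    subst hx
    have hz : Tendsto (fun t : ℝ => ((t⁻¹ : ℝ) : 𝕜) • (U.op t (0 : E) - 0)) (𝓝[≠] 0) (𝓝 y) := hxy
    simp only [map_zero, sub_zero, smul_zero] at hz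
    exact tendsto_nhds_unique hz tendsto_const_nhds
  unfold generator
  rw [Submodule.toLinearPMap_graph_eq _ h]
  rfl

end IsometryGroup

/-! ### The Boas operators -/

/-- The coefficient `A_{m,k}`. -/
def boasA (m : ℕ) (k : ℤ) : ℝ :=
  ((2 * m - 1).factorial : ℝ) / (Real.pi * ((k : ℝ) - 1 / 2) ^ (2 * m)) *
    ∑ j ∈ Finset.range m,
      (-1 : ℝ) ^ j / ((2 * j).factorial : ℝ) * (Real.pi * ((k : ℝ) - 1 / 2)) ^ (2 * j)

/-- The coefficient `B_{m,k}`. -/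
def boasB (m : ℕ) (k : ℤ) : ℝ :=
  if k = 0 then (-1 : ℝ) ^ (m + 1) * Real.pi ^ (2 * m) / (2 * m + 1)
  else
    ((2 * m).factorial : ℝ) / (Real.pi * (k : ℝ) ^ (2 * m + 1)) *
      ∑ j ∈ Finset.range m,
        (-1 : ℝ) ^ j * (Real.pi * (k : ℝ)) ^ (2 * j + 1) / ((2 * j + 1).factorial : ℝ)

/-- The coefficient of order `r`: `B_{m,k}` if `r = 2 m`, and `A_{m,k}` if `r = 2 m - 1`. -/
def boasCoeff (r : ℕ) (k : ℤ) : ℝ :=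
  if Even r then boasB (r / 2) k else boasA ((r + 1) / 2) k

/-- The sampling point: `(π / σ) k` for even `r`, and `(π / σ) (k - 1 / 2)` for odd `r`. -/
def boasNode (r : ℕ) (σ : ℝ) (k : ℤ) : ℝ :=
  if Even r then Real.pi / σ * (k : ℝ) else Real.pi / σ * ((k : ℝ) - 1 / 2)

/-- The `k`-th weight `(σ / π) ^ r (-1) ^ (k + 1) c_k` of the Boas operator of order `r`. -/
def boasWeight (r : ℕ) (σ : ℝ) (k : ℤ) : ℝ :=
  (σ / Real.pi) ^ r * ((-1 : ℝ) ^ (k + 1) * boasCoeff r k)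

theorem summable_pow_div_pow (a : ℝ) (j n : ℕ) (h : j + 2 ≤ n) :
    Summable fun k : ℤ => |((k : ℝ) + a) ^ j / ((k : ℝ) + a) ^ n| := by
  have hs := (Real.summable_one_div_int_add_rpow a ((n - j : ℕ) : ℝ)).2 (by
    have : 1 < n - j := by omega
    exact_mod_cast this)
  refine hs.congr fun k => ?_
  rw [Real.rpow_natCast]
  by_cases hx : (k : ℝ) + a = 0
  · have h1 : n ≠ 0 := by omega
    have h2 : n - j ≠ 0 := by omega
    simp [hx, h1, h2]
  · obtain ⟨d, rfl⟩ : ∃ d, n = j + d := ⟨n - j, by omega⟩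
    rw [abs_div, abs_pow, abs_pow, pow_add, Nat.add_sub_cancel_left]
    have : |(k : ℝ) + a| ≠ 0 := abs_ne_zero.2 hx
    field_simp

theorem summable_boasA (m : ℕ) : Summable (boasA m) := by
  have h : boasA m = fun k : ℤ => ∑ j ∈ Finset.range m,
      ((2 * m - 1).factorial : ℝ) / Real.pi * ((-1 : ℝ) ^ j / ((2 * j).factorial : ℝ)) *
        Real.pi ^ (2 * j) * (((k : ℝ) + (-(1 / 2))) ^ (2 * j) / ((k : ℝ) + (-(1 / 2))) ^ (2 * m)) := by
    funext k
    rw [boasA, Finset.mul_sum]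
    refine Finset.sum_congr rfl fun j _ => ?_
    rw [mul_pow, sub_eq_add_neg]
    ring
  rw [h]
  refine summable_sum fun j hj => Summable.mul_left _ (Summable.of_abs ?_)
  exact summable_pow_div_pow _ _ _ (by have := Finset.mem_range.1 hj; omega)

theorem summable_boasB (m : ℕ) : Summable (boasB m) := by
  have h : Summable fun k : ℤ => ∑ j ∈ Finset.range m,
      ((2 * m).factorial : ℝ) / Real.pi * ((-1 : ℝ) ^ j / ((2 * j + 1).factorial : ℝ)) *
        Real.pi ^ (2 * j + 1) * (((k : ℝ) + 0) ^ (2 * j + 1) / ((k : ℝ) + 0) ^ (2 * m + 1)) := by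
    refine summable_sum fun j hj => Summable.mul_left _ (Summable.of_abs ?_)
    exact summable_pow_div_pow _ _ _ (by have := Finset.mem_range.1 hj; omega)
  refine (summable_congr_cofinite ?_).1 h
  have h0 : ∀ᶠ k : ℤ in cofinite, k ≠ 0 := by
    rw [Filter.eventually_cofinite]
    simp
  filter_upwards [h0] with k hk
  rw [boasB, if_neg hk, Finset.mul_sum]
  refine Finset.sum_congr rfl fun j _ => ?_
  rw [mul_pow, add_zero]
  ring

theorem summable_abs_boasWeight (r : ℕ) (σ : ℝ) : Summable fun k : ℤ => |boasWeight r σ k| := by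
  have hc : Summable (boasCoeff r) := by
    unfold boasCoeff
    split_ifs
    · exact summable_boasB _
    · exact summable_boasA _
  refine (hc.abs.mul_left (|(σ / Real.pi) ^ r|)).congr fun k => ?_
  rw [boasWeight, abs_mul, abs_mul]
  simp

namespace IsometryGroup

variable {𝕜 E : Type*} [RCLike 𝕜] [NormedAddCommGroup E] [NormedSpace 𝕜 E]

theorem norm_boasTerm (U : IsometryGroup 𝕜 E) (r : ℕ) (σ : ℝ) (f : E) (k : ℤ) :
    ‖((boasWeight r σ k : ℝ) : 𝕜) • U.op (boasNode r σ k) f‖ = |boasWeight r σ k| * ‖f‖ := by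
  rw [norm_smul, U.norm_op, RCLike.norm_ofReal]

theorem summable_norm_boasTerm (U : IsometryGroup 𝕜 E) (r : ℕ) (σ : ℝ) (f : E) :
    Summable fun k : ℤ => ‖((boasWeight r σ k : ℝ) : 𝕜) • U.op (boasNode r σ k) f‖ := by
  simp only [norm_boasTerm]
  exact (summable_abs_boasWeight r σ).mul_right _

/-- The Boas operator `𝓑_D ^ (r) (σ)` as a bounded linear operator on `E`: it sends `f` to the sum
of the absolutely convergent series
`(σ / π) ^ r ∑_{k ∈ ℤ} (-1) ^ (k + 1) c_k e ^ (t_k D) f`, where `c_k = A_{m,k}`,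
`t_k = (π / σ) (k - 1 / 2)` if `r = 2 m - 1`, and `c_k = B_{m,k}`, `t_k = π k / σ` if `r = 2 m`. -/
def boasOp [CompleteSpace E] (U : IsometryGroup 𝕜 E) (r : ℕ) (σ : ℝ) : E →L[𝕜] E :=
  LinearMap.mkContinuous
    { toFun := fun f => ∑' k : ℤ, ((boasWeight r σ k : ℝ) : 𝕜) • U.op (boasNode r σ k) f
      map_add' := by
        intro f g
        rw [← Summable.tsum_add (U.summable_norm_boasTerm r σ f).of_norm
          (U.summable_norm_boasTerm r σ g).of_norm]
        simp only [map_add, smul_add]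
      map_smul' := by
        intro c f
        rw [RingHom.id_apply,
          ← Summable.tsum_const_smul c (U.summable_norm_boasTerm r σ f).of_norm]
        refine tsum_congr fun k => ?_
        rw [map_smul, smul_comm] }
    (∑' k : ℤ, |boasWeight r σ k|)
    (by
      intro f
      refine (norm_tsum_le_tsum_norm (U.summable_norm_boasTerm r σ f)).trans (le_of_eq ?_)
      simp only [norm_boasTerm]
      exact tsum_mul_right)

theorem hasSum_boasOp [CompleteSpace E] (U : IsometryGroup 𝕜 E) (r : ℕ) (σ : ℝ) (f : E) :
    HasSum (fun k : ℤ => ((boasWeight r σ k : ℝ) : 𝕜) • U.op (boasNode r σ k) f)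
      (U.boasOp r σ f) :=
  (U.summable_norm_boasTerm r σ f).of_norm.hasSum

end IsometryGroup

end

/-! The weights are Fourier coefficients: those of `(iθ)^r` on `[-π, π]` for even `r`, and of
`(iθ)^r e^{iθ/2}` for odd `r`. Both functions extend continuously to the circle, and the
coefficients are summable, so the symbol `∑ w_k e^{i s_k x}` equals `(ix)^r` on `[-σ, σ]`
(`hasSum_boasWeight_cexp`).

Hence `∑ w_k f(s_k) = f^{(r)}(0)` whenever `𝓕 f` is integrable with frequencies in `[-σ, σ]`. If
only `|f^{(n)}| ≤ C σ^n` is known, `f` is damped by a band-limited factor, with no gain in type, and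
the damping is removed in the limit (`ExpTypeBound.hasSum_boasWeight`). Norming functionals transfer
the formula to orbits `e^{tD} f`, giving `D^r f = 𝓑^{(r)}(σ) f` as soon as `‖D^k f‖ ≤ C σ^k` for
some constant `C` (`eq_boasOp_of_norm_le`).

The weights of order one have `ℓ¹` norm `σ`, so iterating this formula replaces `C` by `‖f‖`
(Bernstein's inequality). This gives linearity of the Bernstein set; closedness follows because
there `D^k` agrees with a bounded operator and `D` has closed graph. Independence of `σ` and the
power formula come from applying the same identity with several `σ` and to shifted orbits. -/

open scoped FourierTransform ContDiff

/-! ### Boas coefficients as Fourier coefficients -/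

/-- The integral `∫ (i θ) ^ r e ^ (-i κ θ) dθ` over `[-π, π]`. -/
noncomputable def fourierMoment (r : ℕ) (κ : ℝ) : ℂ :=
  ∫ θ in (-Real.pi)..Real.pi, (Complex.I * θ) ^ r * Complex.exp (-(Complex.I * κ * θ))

theorem hasDerivAt_cexp_antideriv {κ : ℝ} (hκ : κ ≠ 0) (x : ℝ) :
    HasDerivAt (fun θ : ℝ => Complex.I / κ * Complex.exp (-(Complex.I * κ * (θ : ℂ))))
      (Complex.exp (-(Complex.I * κ * (x : ℂ)))) x := by
  have hκ' : (κ : ℂ) ≠ 0 := by exact_mod_cast hκ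
  have h1 : HasDerivAt (fun θ : ℂ => -(Complex.I * κ * θ)) (-(Complex.I * κ)) (x : ℂ) := by
    simpa using (hasDerivAt_id (x : ℂ)).const_mul (-(Complex.I * κ))
  have h := (h1.cexp.const_mul (Complex.I / κ)).comp_ofReal
  convert! h using 1
  field_simp
  rw [Complex.I_sq]
  ring

theorem fourierMoment_zero {κ : ℝ} (hκ : κ ≠ 0) :
    fourierMoment 0 κ = Complex.I / κ *
      (Complex.exp (-(Complex.I * κ * Real.pi)) - Complex.exp (Complex.I * κ * Real.pi)) := by
  have h := intervalIntegral.integral_eq_sub_of_hasDerivAt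
    (fun x (_ : x ∈ Set.uIcc (-Real.pi) Real.pi) => hasDerivAt_cexp_antideriv hκ x)
    (Continuous.intervalIntegrable (by fun_prop) _ _)
  simp only [fourierMoment, pow_zero, one_mul, h]
  rw [Complex.ofReal_neg, mul_neg, neg_neg]
  ring

theorem fourierMoment_succ (r : ℕ) {κ : ℝ} (hκ : κ ≠ 0) :
    fourierMoment (r + 1) κ =
      ((Complex.I * Real.pi) ^ (r + 1) * Complex.exp (-(Complex.I * κ * Real.pi)) -
        (-(Complex.I * Real.pi)) ^ (r + 1) * Complex.exp (Complex.I * κ * Real.pi)) *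
          (Complex.I / κ) + (r + 1) / κ * fourierMoment r κ := by
  have hκ' : (κ : ℂ) ≠ 0 := by exact_mod_cast hκ
  have hu : ∀ x ∈ Set.uIcc (-Real.pi) Real.pi,
      HasDerivAt (fun θ : ℝ => (Complex.I * (θ : ℂ)) ^ (r + 1))
        ((r + 1) * (Complex.I * (x : ℂ)) ^ r * Complex.I) x := by
    intro x _
    have h := (((hasDerivAt_id (x : ℂ)).const_mul Complex.I).pow (r + 1)).comp_ofReal
    simpa using h
  have h := intervalIntegral.integral_mul_deriv_eq_deriv_mul hu
    (fun x _ => hasDerivAt_cexp_antideriv hκ x)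
    (Continuous.intervalIntegrable (by fun_prop) _ _)
    (Continuous.intervalIntegrable (by fun_prop) _ _)
  have h2 : ∫ x in (-Real.pi)..Real.pi, (r + 1) * (Complex.I * (x : ℂ)) ^ r * Complex.I *
      (Complex.I / κ * Complex.exp (-(Complex.I * κ * (x : ℂ)))) =
      -((r + 1) / κ) * fourierMoment r κ := by
    rw [fourierMoment, ← intervalIntegral.integral_const_mul]
    refine intervalIntegral.integral_congr fun x _ => ?_
    have : Complex.I * Complex.I = -1 := Complex.I_mul_I
    linear_combination ((r + 1) / κ * ((Complex.I * (x : ℂ)) ^ r *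
      Complex.exp (-(Complex.I * κ * (x : ℂ))))) * this
  rw [fourierMoment, h, h2]
  push_cast
  simp only [mul_neg, neg_neg]
  ring

theorem cexp_I_mul_int_mul_pi (k : ℤ) : Complex.exp (Complex.I * (k : ℝ) * Real.pi) = (-1) ^ k := by
  rw [← Complex.exp_pi_mul_I, ← Complex.exp_int_mul]
  congr 1
  push_cast
  ring

theorem cexp_neg_I_mul_int_mul_pi (k : ℤ) :
    Complex.exp (-(Complex.I * (k : ℝ) * Real.pi)) = (-1) ^ k := by
  rw [Complex.exp_neg, cexp_I_mul_int_mul_pi, ← inv_zpow]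
  norm_num

theorem cexp_I_mul_half_int_mul_pi (k : ℤ) :
    Complex.exp (Complex.I * ((k - 1 / 2 : ℝ)) * Real.pi) = (-1) ^ (k + 1) * Complex.I := by
  have : Complex.I * ((k - 1 / 2 : ℝ)) * Real.pi =
      Complex.I * (k : ℝ) * Real.pi + -(Real.pi / 2 * Complex.I) := by push_cast; ring
  rw [this, Complex.exp_add, cexp_I_mul_int_mul_pi, Complex.exp_neg, Complex.exp_pi_div_two_mul_I,
    Complex.inv_I, zpow_add₀ (by norm_num)]
  simp

theorem cexp_neg_I_mul_half_int_mul_pi (k : ℤ) :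
    Complex.exp (-(Complex.I * ((k - 1 / 2 : ℝ)) * Real.pi)) = -((-1) ^ (k + 1) * Complex.I) := by
  rw [Complex.exp_neg, cexp_I_mul_half_int_mul_pi, mul_inv, Complex.inv_I, ← inv_zpow]
  norm_num

theorem half_int_ne_zero (k : ℤ) : (k - 1 / 2 : ℝ) ≠ 0 := by
  intro h
  have h1 : (2 * k : ℝ) = 1 := by linarith
  have h2 : 2 * k = 1 := by exact_mod_cast h1
  omega

theorem neg_one_zpow_succ (k : ℤ) : (-1 : ℂ) ^ (k + 1) = -(-1) ^ k := by
  rw [zpow_add₀ (by norm_num)]; simp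

theorem fourierMoment_even (m : ℕ) (k : ℤ) :
    fourierMoment (2 * m) k = 2 * Real.pi * ((-1) ^ (k + 1) * boasB m k) := by
  have hπ : (Real.pi : ℂ) ≠ 0 := by exact_mod_cast Real.pi_ne_zero
  have hI : ∀ m : ℕ, Complex.I ^ (2 * m) = (-1) ^ m := fun m => by rw [pow_mul, Complex.I_sq]
  rcases eq_or_ne k 0 with rfl | hk
  · have h2 : (2 * m + 1 : ℂ) ≠ 0 := by exact_mod_cast Nat.succ_ne_zero (2 * m)
    have h1 : fourierMoment (2 * m) (0 : ℤ) = ∫ θ in (-Real.pi)..Real.pi,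
        (-1 : ℂ) ^ m * ((θ ^ (2 * m) : ℝ) : ℂ) := by
      refine intervalIntegral.integral_congr fun x _ => ?_
      simp [mul_pow, hI]
    rw [h1, intervalIntegral.integral_const_mul, intervalIntegral.integral_ofReal, integral_pow,
      boasB, if_pos rfl]
    push_cast
    rw [Odd.neg_pow ⟨m, rfl⟩]
    field_simp
    simp
    ring
  · have hk' : (k : ℝ) ≠ 0 := by exact_mod_cast hk
    have hk'' : (k : ℂ) ≠ 0 := by exact_mod_cast hk
    -- Each induction step integrates by parts twice. At integer frequency the even-power boundary
    -- terms cancel, and the odd-power one supplies the new summand of `boasB`.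
    induction m with
    | zero =>
      rw [mul_zero, fourierMoment_zero hk', cexp_I_mul_int_mul_pi, cexp_neg_I_mul_int_mul_pi]
      simp [boasB, hk]
    | succ m ih =>
      have e1 := fourierMoment_succ (2 * m + 1) hk'
      have e2 := fourierMoment_succ (2 * m) hk'
      rw [cexp_I_mul_int_mul_pi, cexp_neg_I_mul_int_mul_pi] at e1 e2
      rw [show 2 * (m + 1) = 2 * m + 1 + 1 by ring, e1, e2, ih, boasB, boasB, if_neg hk, if_neg hk,
        Finset.sum_range_succ, Even.neg_pow ⟨m + 1, by ring⟩, Odd.neg_pow ⟨m, rfl⟩,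
        neg_one_zpow_succ, mul_pow, pow_succ Complex.I (2 * m + 1), pow_succ Complex.I (2 * m), hI,
        show 2 * (m + 1) = 2 * m + 1 + 1 by ring, Nat.factorial_succ (2 * m + 1),
        Nat.factorial_succ (2 * m)]
      have hf : ((2 * m).factorial : ℂ) ≠ 0 := by exact_mod_cast Nat.factorial_ne_zero _
      have h2 : (2 * m + 1 : ℂ) ≠ 0 := by exact_mod_cast Nat.succ_ne_zero (2 * m)
      push_cast
      generalize Finset.sum (M := ℂ) _ _ = S
      field_simp
      ring_nf
      simp only [Complex.I_sq, show Complex.I ^ (m * 2) = (-1) ^ m by rw [mul_comm, hI]]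
      ring

theorem fourierMoment_odd (m : ℕ) (k : ℤ) :
    fourierMoment (2 * m + 1) (k - 1 / 2) =
      2 * Real.pi * ((-1) ^ (k + 1) * boasA (m + 1) k) := by
  have hπ : (Real.pi : ℂ) ≠ 0 := by exact_mod_cast Real.pi_ne_zero
  have hI : ∀ m : ℕ, Complex.I ^ (2 * m) = (-1) ^ m := fun m => by rw [pow_mul, Complex.I_sq]
  have hk := half_int_ne_zero k
  have hA : ∀ m, boasA m k = ((2 * m - 1).factorial : ℝ) / (Real.pi * (k - 1 / 2 : ℝ) ^ (2 * m)) *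
    ∑ j ∈ Finset.range m, (-1 : ℝ) ^ j / ((2 * j).factorial : ℝ) *
      (Real.pi * (k - 1 / 2 : ℝ)) ^ (2 * j) := fun m => rfl
  have e3 := cexp_I_mul_half_int_mul_pi k
  have e4 := cexp_neg_I_mul_half_int_mul_pi k
  simp only [hA]
  generalize (k - 1 / 2 : ℝ) = κ at *
  have hκ : (κ : ℂ) ≠ 0 := by exact_mod_cast hk
  -- At half-integer frequency the two endpoint exponentials are opposite, so here the odd-power
  -- boundary terms cancel and the even-power one survives.
  induction m with
  | zero =>
    rw [fourierMoment_succ _ hk, mul_zero, fourierMoment_zero hk, e3, e4]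
    simp
    field_simp
    rw [Complex.I_sq]
    ring
  | succ m ih =>
    rw [show 2 * (m + 1) + 1 = 2 * m + 1 + 1 + 1 by ring, fourierMoment_succ _ hk,
      fourierMoment_succ (2 * m + 1) hk, e3, e4, ih, Finset.sum_range_succ _ (m + 1),
      Odd.neg_pow ⟨m + 1, by ring⟩, Even.neg_pow ⟨m + 1, by ring⟩,
      show 2 * (m + 1 + 1) - 1 = 2 * m + 1 + 1 + 1 by omega,
      show 2 * (m + 1) - 1 = 2 * m + 1 by omega, Nat.factorial_succ (2 * m + 1 + 1),
      show 2 * (m + 1) = 2 * m + 1 + 1 by ring, Nat.factorial_succ (2 * m + 1)]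
    have hf : ((2 * m + 1).factorial : ℂ) ≠ 0 := by exact_mod_cast Nat.factorial_ne_zero _
    have h2 : (2 * m + 1 + 1 : ℂ) ≠ 0 := by exact_mod_cast Nat.succ_ne_zero (2 * m + 1)
    have h3 : (Complex.I * (Real.pi : ℂ)) ^ (2 * m + 1 + 1) =
        (-1) ^ (m + 1) * (Real.pi : ℂ) ^ (2 * m + 1 + 1) := by
      rw [mul_pow, ← hI]; congr 2
    rw [h3]
    push_cast
    generalize Finset.sum (M := ℂ) _ _ = S
    generalize (-1 : ℂ) ^ (k + 1) = s
    field_simp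
    ring_nf
    simp only [Complex.I_sq]
    ring

/-! ### The symbol of the Boas operators -/

/-- Equal endpoint values let `g` descend to a continuous function on the circle, whose Fourier
series converges pointwise once its coefficients are summable. -/
theorem hasSum_fourier_of_summable_coeff {g : ℝ → ℂ} (hg : Continuous g)
    (hper : g (-Real.pi) = g Real.pi) {c : ℤ → ℂ}
    (hc : ∀ k : ℤ, ∫ θ in (-Real.pi)..Real.pi, Complex.exp (-(Complex.I * k * θ)) * g θ =
      2 * Real.pi * c k)
    (hs : Summable c) {θ : ℝ} (hθ : θ ∈ Set.Icc (-Real.pi) Real.pi) :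
    HasSum (fun k : ℤ => c k * Complex.exp (Complex.I * k * θ)) (g θ) := by
  have : Fact (0 < 2 * Real.pi) := ⟨Real.two_pi_pos⟩
  have hπ : (Real.pi : ℂ) ≠ 0 := by exact_mod_cast Real.pi_ne_zero
  have hend : -Real.pi + 2 * Real.pi = Real.pi := by ring
  have hfour : ∀ (k : ℤ) (x : ℝ), fourier k (x : AddCircle (2 * Real.pi)) =
      Complex.exp (Complex.I * k * x) := by
    intro k x
    rw [fourier_coe_apply]
    congr 1
    push_cast
    field_simp
  let G : C(AddCircle (2 * Real.pi), ℂ) :=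
    ⟨AddCircle.liftIco (2 * Real.pi) (-Real.pi) g,
      AddCircle.liftIco_continuous (by rw [hend, hper]) hg.continuousOn⟩
  have hcoe : ∀ x ∈ Set.Ico (-Real.pi) Real.pi, G (x : AddCircle (2 * Real.pi)) = g x := by
    intro x hx
    exact AddCircle.liftIco_coe_apply (by rwa [hend])
  have hcoeff : ∀ k, fourierCoeff G k = c k := by
    intro k
    rw [fourierCoeff_eq_intervalIntegral G k (-Real.pi), hend]
    have : ∫ x in (-Real.pi)..Real.pi, fourier (-k) (x : AddCircle (2 * Real.pi)) •
        G (x : AddCircle (2 * Real.pi)) = 2 * Real.pi * c k := by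
      rw [← hc k]
      refine intervalIntegral.integral_congr_Ioo_of_le (by linarith [Real.pi_pos]) fun x hx => ?_
      rw [hcoe x ⟨hx.1.le, hx.2⟩, hfour, smul_eq_mul]
      push_cast
      congr 2
      ring
    rw [this, Complex.real_smul]
    push_cast
    field_simp
  have hs' : Summable (fourierCoeff G) := hs.congr fun k => (hcoeff k).symm
  have key : ∀ x ∈ Set.Ico (-Real.pi) Real.pi,
      HasSum (fun k : ℤ => c k * Complex.exp (Complex.I * k * x)) (g x) := by
    intro x hx
    have h := has_pointwise_sum_fourier_series_of_summable hs' (x : AddCircle (2 * Real.pi))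
    simpa only [hcoeff, hfour, hcoe x hx, smul_eq_mul] using h
  -- The fundamental domain omits `π`; there the series agrees term by term with the one at `-π`.
  rcases eq_or_lt_of_le hθ.2 with rfl | h
  · have h := key (-Real.pi) ⟨le_rfl, by linarith [Real.pi_pos]⟩
    rw [hper] at h
    refine h.congr_fun fun k => ?_
    have e1 := cexp_I_mul_int_mul_pi k
    have e2 := cexp_neg_I_mul_int_mul_pi k
    push_cast at e1 e2 ⊢
    rw [e1, mul_neg, e2]
  · exact key θ ⟨hθ.1, h⟩

theorem summable_boasCoeff (r : ℕ) : Summable (boasCoeff r) := by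
  unfold boasCoeff
  split_ifs
  · exact summable_boasB _
  · exact summable_boasA _

theorem summable_ofReal_boasCoeff (r : ℕ) :
    Summable fun k : ℤ => (-1 : ℂ) ^ (k + 1) * (boasCoeff r k : ℂ) := by
  refine Summable.of_norm ((summable_boasCoeff r).abs.congr fun k => ?_)
  simp

theorem boasWeight_mul_cexp_boasNode {σ : ℝ} (hσ : 0 < σ) (r : ℕ) (x : ℝ) (k : ℤ) :
    (boasWeight r σ k : ℂ) * Complex.exp (Complex.I * boasNode r σ k * x) =
      (σ / Real.pi : ℂ) ^ r * ((-1) ^ (k + 1) * boasCoeff r k *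
        (Complex.exp (Complex.I * k * (Real.pi * x / σ : ℝ)) *
          if Even r then 1 else Complex.exp (-(Complex.I * (Real.pi * x / σ : ℝ) / 2)))) := by
  have hσ' : (σ : ℂ) ≠ 0 := by exact_mod_cast hσ.ne'
  rw [boasWeight, boasNode]
  split_ifs
  · push_cast
    rw [mul_one, show Complex.I * (Real.pi / σ * k : ℂ) * x = Complex.I * k * (Real.pi * x / σ) by
      field_simp]
    ring
  · rw [← Complex.exp_add]
    push_cast
    rw [show Complex.I * (Real.pi / σ * (k - 1 / 2) : ℂ) * x =
      Complex.I * k * (Real.pi * x / σ) + -(Complex.I * (Real.pi * x / σ) / 2) by field_simp; ring]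
    ring

/-- The symbol of the Boas operator of order `r` equals `(i x) ^ r` on `[-σ, σ]`. -/
theorem hasSum_boasWeight_cexp {σ : ℝ} (hσ : 0 < σ) (r : ℕ) {x : ℝ}
    (hx : |x| ≤ σ) :
    HasSum (fun k : ℤ => (boasWeight r σ k : ℂ) * Complex.exp (Complex.I * boasNode r σ k * x))
      ((Complex.I * x) ^ r) := by
  have hσ' : (σ : ℂ) ≠ 0 := by exact_mod_cast hσ.ne'
  have hπ : (Real.pi : ℂ) ≠ 0 := by exact_mod_cast Real.pi_ne_zero
  have hπx : Real.pi * x / σ ∈ Set.Icc (-Real.pi) Real.pi := by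
    rw [Set.mem_Icc, ← abs_le, abs_div, abs_mul, abs_of_pos hσ, abs_of_pos Real.pi_pos, div_le_iff₀ hσ]
    exact mul_le_mul_of_nonneg_left hx Real.pi_pos.le
  have hval : (Complex.I * x) ^ r =
      (σ / Real.pi : ℂ) ^ r * (Complex.I * (Real.pi * x / σ : ℝ)) ^ r := by
    rw [← mul_pow]
    push_cast
    congr 1
    field_simp
  rw [hval]
  simp_rw [boasWeight_mul_cexp_boasNode hσ]
  generalize Real.pi * x / σ = θ at *
  refine HasSum.mul_left _ ?_
  have hs := summable_ofReal_boasCoeff r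
  by_cases hr : Even r
  · obtain ⟨m, rfl⟩ := even_iff_exists_two_mul.1 hr
    simp only [hr, if_true, mul_one]
    refine hasSum_fourier_of_summable_coeff (g := fun θ : ℝ => (Complex.I * θ) ^ (2 * m))
      (by fun_prop) ?_ ?_ hs hπx
    · push_cast
      rw [mul_neg, Even.neg_pow (by simp)]
    · intro k
      have h := fourierMoment_even m k
      rw [boasCoeff, if_pos hr, show 2 * m / 2 = m by omega, ← h, fourierMoment]
      refine intervalIntegral.integral_congr fun x _ => ?_
      push_cast
      ring
  · obtain ⟨m, rfl⟩ := Nat.not_even_iff_odd.1 hr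
    simp only [hr, if_false]
    -- An odd power jumps at `±π`. The factor `e^{iθ/2}` also changes sign between the endpoints,
    -- which restores continuity and accounts for the half-integer nodes.
    have h := hasSum_fourier_of_summable_coeff
      (g := fun θ : ℝ => (Complex.I * θ) ^ (2 * m + 1) * Complex.exp (Complex.I * θ / 2))
      (c := fun k => (-1) ^ (k + 1) * (boasCoeff (2 * m + 1) k : ℂ))
      (by fun_prop) ?_ ?_ hs hπx
    · have h2 := h.mul_right (Complex.exp (-(Complex.I * θ / 2)))
      rw [mul_assoc, ← Complex.exp_add, add_neg_cancel, Complex.exp_zero, mul_one] at h2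
      simpa only [mul_assoc] using h2
    · push_cast
      rw [mul_neg, Odd.neg_pow ⟨m, rfl⟩,
        show Complex.I * (Real.pi : ℂ) / 2 = Real.pi / 2 * Complex.I by ring,
        show -(Complex.I * (Real.pi : ℂ)) / 2 = -(Real.pi / 2 * Complex.I) by ring,
        Complex.exp_neg, Complex.exp_pi_div_two_mul_I, Complex.inv_I]
      ring
    · intro k
      have h := fourierMoment_odd m k
      rw [boasCoeff, if_neg hr, show (2 * m + 1 + 1) / 2 = m + 1 by omega, ← h, fourierMoment]
      refine intervalIntegral.integral_congr fun x _ => ?_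
      rw [mul_left_comm, ← Complex.exp_add]
      congr 2
      push_cast
      ring

/-- At `x = σ` the exponential is `(-1)^{k+1} i`, which cancels the sign of the weight because
`A_{1,k} ≥ 0`. The symbol there is thus `i` times the sum of the absolute weights. -/
theorem boasWeight_one_mul_cexp {σ : ℝ} (hσ : 0 < σ) (k : ℤ) :
    (boasWeight 1 σ k : ℂ) * Complex.exp (Complex.I * boasNode 1 σ k * σ) =
      ((|boasWeight 1 σ k| : ℝ) : ℂ) * Complex.I := by
  have hσ' : (σ : ℂ) ≠ 0 := by exact_mod_cast hσ.ne'
  have hA : 0 ≤ boasA 1 k := by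
    simp only [boasA]
    simpa using by positivity
  have hw : boasWeight 1 σ k = (-1) ^ (k + 1) * (σ / Real.pi * boasA 1 k) := by
    simp [boasWeight, boasCoeff]; ring
  have habs : |boasWeight 1 σ k| = σ / Real.pi * boasA 1 k := by
    rw [hw, abs_mul, abs_of_nonneg (mul_nonneg (div_pos hσ Real.pi_pos).le hA)]
    simp
  have hnode : Complex.I * boasNode 1 σ k * σ = Complex.I * ((k - 1 / 2 : ℝ)) * Real.pi := by
    simp [boasNode]
    field_simp
  have hsq : ((-1 : ℂ) ^ (k + 1)) * (-1) ^ (k + 1) = 1 := by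
    rw [← mul_zpow]; norm_num
  rw [hnode, cexp_I_mul_half_int_mul_pi, habs, hw]
  push_cast
  linear_combination (σ / Real.pi * boasA 1 k * Complex.I : ℂ) * hsq

theorem hasSum_abs_boasWeight_one {σ : ℝ} (hσ : 0 < σ) :
    HasSum (fun k : ℤ => |boasWeight 1 σ k|) σ := by
  have h := hasSum_boasWeight_cexp hσ 1 (abs_of_pos hσ).le
  simp only [boasWeight_one_mul_cexp hσ, pow_one] at h
  rw [mul_comm, hasSum_mul_right_iff Complex.I_ne_zero] at h
  exact_mod_cast h

/-! ### Functions of exponential type and their Fourier transforms -/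

/-- `f` is smooth and `‖f⁽ⁿ⁾ t‖ ≤ a ^ n w(t)` for all `n` and `t`. -/
structure ExpTypeBound (f : ℝ → ℂ) (a : ℝ) (w : ℝ → ℝ) : Prop where
  contDiff : ContDiff ℝ ∞ f
  norm_iteratedDeriv_le : ∀ n t, ‖iteratedDeriv n f t‖ ≤ a ^ n * w t

theorem contDiff_of_hasDerivAt_succ {F : ℕ → ℝ → ℂ}
    (hF : ∀ n t, HasDerivAt (F n) (F (n + 1) t) t) : ContDiff ℝ ∞ (F 0) := by
  have : ∀ (n : ℕ) k, ContDiff ℝ n (F k) := by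
    intro n
    induction n with
    | zero =>
      intro k
      exact contDiff_zero.2 (continuous_iff_continuousAt.2 fun t => (hF k t).continuousAt)
    | succ n ih =>
      intro k
      push_cast
      rw [contDiff_succ_iff_deriv]
      refine ⟨fun t => (hF k t).differentiableAt, by simp, ?_⟩
      rw [funext fun t => (hF k t).deriv]
      exact ih _
  exact contDiff_infty.2 fun n => this n 0

theorem iteratedDeriv_of_hasDerivAt_succ {F : ℕ → ℝ → ℂ}
    (hF : ∀ n t, HasDerivAt (F n) (F (n + 1) t) t) (n : ℕ) : iteratedDeriv n (F 0) = F n := by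
  induction n with
  | zero => simp
  | succ n ih =>
    rw [iteratedDeriv_succ, ih]
    exact funext fun t => (hF n t).deriv

theorem ExpTypeBound.of_hasDerivAt_succ {F : ℕ → ℝ → ℂ} {a : ℝ} {w : ℝ → ℝ}
    (hF : ∀ n t, HasDerivAt (F n) (F (n + 1) t) t) (hb : ∀ n t, ‖F n t‖ ≤ a ^ n * w t) :
    ExpTypeBound (F 0) a w :=
  ⟨contDiff_of_hasDerivAt_succ hF, fun n t => by
    rw [iteratedDeriv_of_hasDerivAt_succ hF]; exact hb n t⟩

namespace ExpTypeBound

variable {f g : ℝ → ℂ} {a b : ℝ} {v w : ℝ → ℝ}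

theorem weight_nonneg (hf : ExpTypeBound f a w) (t : ℝ) : 0 ≤ w t := by
  have := hf.norm_iteratedDeriv_le 0 t
  rw [pow_zero, one_mul] at this
  exact (norm_nonneg _).trans this

theorem contDiff_nat (hf : ExpTypeBound f a w) (n : ℕ) : ContDiff ℝ n f :=
  contDiff_infty.1 hf.contDiff n

/-- Leibniz' rule matches the binomial expansion of `(a + b)^n`, so types add and weights multiply.
-/
theorem mul (hf : ExpTypeBound f a v) (hg : ExpTypeBound g b w) (ha : 0 ≤ a) :
    ExpTypeBound (fun t => f t * g t) (a + b) (fun t => v t * w t) := by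
  refine ⟨hf.contDiff.mul hg.contDiff, fun n t => ?_⟩
  have h := iteratedDeriv_mul (hf.contDiff_nat n).contDiffAt (hg.contDiff_nat n).contDiffAt (x := t)
  change ‖iteratedDeriv n (f * g) t‖ ≤ _
  rw [h, add_pow, Finset.sum_mul]
  refine (norm_sum_le _ _).trans (Finset.sum_le_sum fun i _ => ?_)
  rw [norm_mul, norm_mul, Complex.norm_natCast]
  have h1 := hf.norm_iteratedDeriv_le i t
  have h2 := hg.norm_iteratedDeriv_le (n - i) t
  calc _ ≤ (n.choose i : ℝ) * (a ^ i * v t) * (b ^ (n - i) * w t) := by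
        have := hf.weight_nonneg t
        gcongr
    _ = _ := by ring

theorem comp_mul (hf : ExpTypeBound f a w) (c : ℝ) :
    ExpTypeBound (fun t => f (c * t)) (|c| * a) (fun t => w (c * t)) := by
  refine ⟨hf.contDiff.comp (contDiff_const.mul contDiff_id), fun n t => ?_⟩
  rw [iteratedDeriv_comp_const_smul (hf.contDiff_nat n), norm_smul, mul_pow, mul_assoc, norm_pow,
    Real.norm_eq_abs]
  exact mul_le_mul_of_nonneg_left (hf.norm_iteratedDeriv_le n _) (by positivity)

theorem mono_weight (hf : ExpTypeBound f a v) (ha : 0 ≤ a) (h : ∀ t, v t ≤ w t) :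
    ExpTypeBound f a w :=
  ⟨hf.contDiff, fun n t => (hf.norm_iteratedDeriv_le n t).trans
    (mul_le_mul_of_nonneg_left (h t) (by positivity))⟩

theorem integrable_iteratedDeriv (hf : ExpTypeBound f a w) (hw : MeasureTheory.Integrable w)
    (n : ℕ) : MeasureTheory.Integrable (iteratedDeriv n f) := by
  refine (hw.const_mul (a ^ n)).mono' ?_ (Eventually.of_forall (hf.norm_iteratedDeriv_le n))
  exact ((hf.contDiff_nat n).continuous_iteratedDeriv n le_rfl).aestronglyMeasurable

theorem fourier_iteratedDeriv (hf : ExpTypeBound f a w) (hw : MeasureTheory.Integrable w)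
    (n : ℕ) (ξ : ℝ) :
    𝓕 (iteratedDeriv n f) ξ = (2 * Real.pi * Complex.I * ξ) ^ n * 𝓕 f ξ := by
  have h := Real.fourier_iteratedDeriv (f := f) (N := (n : ℕ∞)) (n := n)
    (by exact_mod_cast hf.contDiff_nat n)
    (fun k _ => hf.integrable_iteratedDeriv hw k) le_rfl
  rw [h]
  rfl

/-- A Paley–Wiener argument without complex analysis: `|2πξ|^n ‖𝓕 f ξ‖ ≤ a^n ∫ w` for every `n`, and
`(a / |2πξ|)^n` tends to zero. -/
theorem fourier_eq_zero (hf : ExpTypeBound f a w) (hw : MeasureTheory.Integrable w) (ha : 0 ≤ a)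
    {ξ : ℝ} (hξ : a < |2 * Real.pi * ξ|) : 𝓕 f ξ = 0 := by
  set C := ∫ t, w t
  have hpos : 0 < |2 * Real.pi * ξ| := ha.trans_lt hξ
  have hb : ∀ n : ℕ, ‖𝓕 f ξ‖ ≤ (a / |2 * Real.pi * ξ|) ^ n * C := by
    intro n
    have h1 : ‖𝓕 (iteratedDeriv n f) ξ‖ ≤ a ^ n * C := by
      refine (VectorFourier.norm_fourierIntegral_le_integral_norm _ _ _ _ _).trans ?_
      rw [← MeasureTheory.integral_const_mul]
      exact MeasureTheory.integral_mono (hf.integrable_iteratedDeriv hw n).norm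
        (hw.const_mul _) (hf.norm_iteratedDeriv_le n)
    rw [hf.fourier_iteratedDeriv hw, norm_mul, norm_pow] at h1
    have h2 : ‖(2 * Real.pi * Complex.I * ξ : ℂ)‖ = |2 * Real.pi * ξ| := by
      simp [abs_mul]
    rw [h2] at h1
    rw [div_pow, div_mul_eq_mul_div, le_div_iff₀ (by positivity), mul_comm]
    exact h1
  have hlim : Tendsto (fun n : ℕ => (a / |2 * Real.pi * ξ|) ^ n * C) atTop (𝓝 (0 * C)) :=
    (tendsto_pow_atTop_nhds_zero_of_lt_one (by positivity)
      ((div_lt_one hpos).2 hξ)).mul_const C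
  rw [zero_mul] at hlim
  exact norm_le_zero_iff.1 (ge_of_tendsto' hlim hb)

theorem integrable_fourier (hf : ExpTypeBound f a w) (hw : MeasureTheory.Integrable w)
    (ha : 0 ≤ a) : MeasureTheory.Integrable (𝓕 f) := by
  have h0 : MeasureTheory.Integrable f := by simpa using hf.integrable_iteratedDeriv hw 0
  have hc : Continuous (𝓕 f) := by
    refine VectorFourier.fourierIntegral_continuous Real.continuous_fourierChar ?_ h0
    exact continuous_inner
  refine hc.integrable_of_hasCompactSupport
    (HasCompactSupport.intro (isCompact_Icc (a := -a) (b := a)) fun ξ hξ => ?_)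
  refine hf.fourier_eq_zero hw ha ?_
  have h1 : a < |ξ| := by
    by_contra h
    exact hξ (abs_le.1 (not_lt.1 h))
  rw [abs_mul, abs_of_pos Real.two_pi_pos]
  nlinarith [Real.pi_gt_three, abs_nonneg ξ]

theorem eq_integral_fourier (hf : ExpTypeBound f a w) (hw : MeasureTheory.Integrable w)
    (ha : 0 ≤ a) (t : ℝ) :
    f t = ∫ ξ : ℝ, Complex.exp (Complex.I * t * (2 * Real.pi * ξ : ℝ)) * 𝓕 f ξ := by
  have h0 : MeasureTheory.Integrable f := by simpa using hf.integrable_iteratedDeriv hw 0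
  have h := h0.fourierInv_fourier_eq (hf.integrable_fourier hw ha)
    (v := t) hf.contDiff.continuous.continuousAt
  conv_lhs => rw [← h, Real.fourierInv_eq']
  refine MeasureTheory.integral_congr_ae (Eventually.of_forall fun ξ => ?_)
  simp only [smul_eq_mul]
  congr 2
  simp
  ring

theorem iteratedDeriv_zero_eq_integral_fourier (hf : ExpTypeBound f a w)
    (hw : MeasureTheory.Integrable w) (ha : 0 ≤ a) (r : ℕ) :
    iteratedDeriv r f 0 = ∫ ξ : ℝ, (Complex.I * (2 * Real.pi * ξ : ℝ)) ^ r * 𝓕 f ξ := by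
  have hr : ExpTypeBound (iteratedDeriv r f) a (fun t => a ^ r * w t) := by
    refine ⟨?_, fun n t => ?_⟩
    · exact contDiff_infty.2 fun n => by
        rw [iteratedDeriv_eq_iterate]
        exact (hf.contDiff_nat (n + r)).iterate_deriv' n r
    · rw [iteratedDeriv_eq_iterate, iteratedDeriv_eq_iterate, ← Function.iterate_add_apply,
        ← iteratedDeriv_eq_iterate, ← mul_assoc, ← pow_add]
      exact hf.norm_iteratedDeriv_le _ _
  rw [hr.eq_integral_fourier (hw.const_mul _) ha]
  refine MeasureTheory.integral_congr_ae (Eventually.of_forall fun ξ => ?_)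
  simp only [hf.fourier_iteratedDeriv hw]
  push_cast
  rw [mul_zero, zero_mul, Complex.exp_zero, one_mul]
  congr 2
  ring

/-- Fourier inversion turns the samples into integrals, and `‖c k‖ ‖𝓕 f‖` dominates when sum and
integral are exchanged. The symbol identity is needed only for `|2πξ| ≤ a`, since `𝓕 f` vanishes
elsewhere. -/
theorem hasSum_of_hasSum_symbol (hf : ExpTypeBound f a w)
    (hw : MeasureTheory.Integrable w) (ha : 0 ≤ a) (r : ℕ) {c : ℤ → ℂ} {s : ℤ → ℝ}
    (hc : Summable fun k => ‖c k‖)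
    (hsymb : ∀ x : ℝ, |x| ≤ a →
      HasSum (fun k => c k * Complex.exp (Complex.I * s k * x)) ((Complex.I * x) ^ r)) :
    HasSum (fun k => c k * f (s k)) (iteratedDeriv r f 0) := by
  rw [hf.iteratedDeriv_zero_eq_integral_fourier hw ha]
  have hF := hf.integrable_fourier hw ha
  simp_rw [hf.eq_integral_fourier hw ha (s _), ← MeasureTheory.integral_const_mul]
  have hnorm : ∀ k (ξ : ℝ), ‖Complex.exp (Complex.I * s k * (2 * Real.pi * ξ : ℝ))‖ = 1 := by
    intro k ξ
    rw [Complex.norm_exp]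
    simp
  refine MeasureTheory.hasSum_integral_of_dominated_convergence
    (fun k ξ => ‖c k‖ * ‖𝓕 f ξ‖) (fun k => ?_) (fun k => ?_) ?_ ?_ ?_
  · refine (MeasureTheory.AEStronglyMeasurable.mul ?_ hF.1).const_mul _
    exact (by fun_prop : Continuous fun ξ : ℝ =>
      Complex.exp (Complex.I * s k * (2 * Real.pi * ξ : ℝ))).aestronglyMeasurable
  · refine Eventually.of_forall fun ξ => ?_
    rw [norm_mul, norm_mul, hnorm, one_mul]
  · exact Eventually.of_forall fun ξ => hc.mul_right _
  · simp_rw [tsum_mul_right]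
    exact hF.norm.const_mul _
  · refine Eventually.of_forall fun ξ => ?_
    by_cases h : |2 * Real.pi * ξ| ≤ a
    · have := (hsymb _ h).mul_right (𝓕 f ξ)
      simpa only [mul_assoc] using this
    · rw [hf.fourier_eq_zero hw ha (not_le.1 h)]
      simp

end ExpTypeBound

/-! ### A band-limited damping factor -/

/-- The `n`-th derivative of `x ↦ ∫ u in 0..1, e ^ (i x u)`. -/
noncomputable def unitBandKernel (n : ℕ) (x : ℝ) : ℂ :=
  ∫ u in (0 : ℝ)..1, (Complex.I * u) ^ n * Complex.exp (Complex.I * x * u)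

theorem norm_I_mul_pow_mul_cexp (n : ℕ) (x : ℝ) (u : ℝ) :
    ‖(Complex.I * u) ^ n * Complex.exp (Complex.I * x * u)‖ = |u| ^ n := by
  rw [norm_mul, Complex.norm_exp]
  simp

theorem hasDerivAt_unitBandKernel (n : ℕ) (x : ℝ) :
    HasDerivAt (unitBandKernel n) (unitBandKernel (n + 1) x) x := by
  refine (intervalIntegral.hasDerivAt_integral_of_dominated_loc_of_deriv_le
    (F := fun (x u : ℝ) => (Complex.I * u) ^ n * Complex.exp (Complex.I * x * u))
    (F' := fun (x u : ℝ) => (Complex.I * u) ^ (n + 1) * Complex.exp (Complex.I * x * u))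
    (bound := fun _ => 1) (s := Set.univ) univ_mem
    (Eventually.of_forall fun y => Continuous.aestronglyMeasurable (by fun_prop))
    (Continuous.intervalIntegrable (by fun_prop) _ _)
    (Continuous.aestronglyMeasurable (by fun_prop)) ?_ (by simp) ?_).2
  · refine Eventually.of_forall fun u hu y _ => ?_
    rw [norm_I_mul_pow_mul_cexp]
    rw [Set.uIoc_of_le zero_le_one] at hu
    exact pow_le_one₀ (abs_nonneg u) (by rw [abs_of_pos hu.1]; exact hu.2)
  · refine Eventually.of_forall fun u _ y _ => ?_
    have h1 : HasDerivAt (fun z : ℂ => Complex.I * z * u) (Complex.I * u) (y : ℂ) := by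
      simpa using ((hasDerivAt_id (y : ℂ)).const_mul Complex.I).mul_const (u : ℂ)
    have h := (h1.cexp.const_mul ((Complex.I * u) ^ n)).comp_ofReal
    convert! h using 1
    ring

theorem norm_unitBandKernel_le_one (n : ℕ) (x : ℝ) : ‖unitBandKernel n x‖ ≤ 1 := by
  have h := intervalIntegral.norm_integral_le_of_norm_le_const (a := 0) (b := 1) (C := 1)
    (f := fun u : ℝ => (Complex.I * u) ^ n * Complex.exp (Complex.I * x * u)) fun u hu => by
      rw [norm_I_mul_pow_mul_cexp]
      rw [Set.uIoc_of_le zero_le_one] at hu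
      exact pow_le_one₀ (abs_nonneg u) (by rw [abs_of_pos hu.1]; exact hu.2)
  simpa [unitBandKernel] using h

/-- The factor `n + 1` produced by integration by parts is absorbed by `∫ u^n = 1 / (n + 1)`; this
keeps the decay estimate uniform in `n`. -/
theorem norm_succ_mul_unitBandKernel_le_one (n : ℕ) (x : ℝ) :
    ‖(n + 1) * unitBandKernel n x‖ ≤ 1 := by
  have h := intervalIntegral.norm_integral_le_of_norm_le (a := 0) (b := 1)
    (μ := MeasureTheory.volume)
    (f := fun u : ℝ => (Complex.I * u) ^ n * Complex.exp (Complex.I * x * u))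
    (g := fun u => u ^ n) zero_le_one
    (Eventually.of_forall fun u hu => by
      rw [norm_I_mul_pow_mul_cexp, abs_of_pos hu.1]) (by simp)
  rw [integral_pow] at h
  simp only [one_pow, ne_eq, Nat.succ_ne_zero, not_false_eq_true, zero_pow, sub_zero] at h
  rw [norm_mul]
  have h2 : ‖(n + 1 : ℂ)‖ = n + 1 := by exact_mod_cast Complex.norm_natCast (n + 1)
  have hpos : (0 : ℝ) < n + 1 := by positivity
  rw [h2]
  calc ((n : ℝ) + 1) * ‖unitBandKernel n x‖ ≤ (n + 1) * (1 / (n + 1)) :=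
        mul_le_mul_of_nonneg_left h hpos.le
    _ = 1 := by field_simp

theorem I_mul_unitBandKernel_zero (x : ℝ) :
    Complex.I * x * unitBandKernel 0 x = Complex.exp (Complex.I * x) - 1 := by
  have hd : ∀ u ∈ Set.uIcc (0 : ℝ) 1,
      HasDerivAt (fun u : ℝ => Complex.exp (Complex.I * x * u))
        (Complex.exp (Complex.I * x * u) * (Complex.I * x)) u := by
    intro u _
    have h1 : HasDerivAt (fun z : ℂ => Complex.I * x * z) (Complex.I * x) (u : ℂ) := by
      simpa using (hasDerivAt_id (u : ℂ)).const_mul (Complex.I * x)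
    exact h1.cexp.comp_ofReal
  have h := intervalIntegral.integral_eq_sub_of_hasDerivAt hd
    (Continuous.intervalIntegrable (by fun_prop) _ _)
  rw [intervalIntegral.integral_mul_const] at h
  simp only [unitBandKernel, pow_zero, one_mul]
  rw [mul_comm, h]
  simp

theorem I_mul_unitBandKernel_succ (n : ℕ) (x : ℝ) :
    Complex.I * x * unitBandKernel (n + 1) x =
      Complex.I ^ (n + 1) * Complex.exp (Complex.I * x) -
        Complex.I * ((n + 1) * unitBandKernel n x) := by
  have hd : ∀ u ∈ Set.uIcc (0 : ℝ) 1,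
      HasDerivAt (fun u : ℝ => Complex.exp (Complex.I * x * u))
        (Complex.exp (Complex.I * x * u) * (Complex.I * x)) u := by
    intro u _
    have h1 : HasDerivAt (fun z : ℂ => Complex.I * x * z) (Complex.I * x) (u : ℂ) := by
      simpa using (hasDerivAt_id (u : ℂ)).const_mul (Complex.I * x)
    exact h1.cexp.comp_ofReal
  have hu : ∀ u ∈ Set.uIcc (0 : ℝ) 1,
      HasDerivAt (fun u : ℝ => (Complex.I * (u : ℂ)) ^ (n + 1))
        ((n + 1) * (Complex.I * (u : ℂ)) ^ n * Complex.I) u := by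
    intro u _
    have h := (((hasDerivAt_id (u : ℂ)).const_mul Complex.I).pow (n + 1)).comp_ofReal
    simpa using h
  have h := intervalIntegral.integral_mul_deriv_eq_deriv_mul hu hd
    (Continuous.intervalIntegrable (by fun_prop) _ _)
    (Continuous.intervalIntegrable (by fun_prop) _ _)
  simp only [unitBandKernel]
  rw [← intervalIntegral.integral_const_mul, ← intervalIntegral.integral_const_mul,
    ← intervalIntegral.integral_const_mul]
  have e1 : ∫ u in (0 : ℝ)..1, Complex.I * x * ((Complex.I * u) ^ (n + 1) *
      Complex.exp (Complex.I * x * u)) = ∫ u in (0 : ℝ)..1, (Complex.I * (u : ℂ)) ^ (n + 1) *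
      (Complex.exp (Complex.I * x * u) * (Complex.I * x)) :=
    intervalIntegral.integral_congr fun u _ => by ring
  rw [e1, h]
  congr 1
  · simp
  · exact intervalIntegral.integral_congr fun u _ => by ring

theorem norm_unitBandKernel_le (n : ℕ) (x : ℝ) : ‖unitBandKernel n x‖ ≤ 3 / (1 + |x|) := by
  have h1 := norm_unitBandKernel_le_one n x
  have hexp : ‖Complex.exp (Complex.I * x)‖ = 1 := by
    rw [Complex.norm_exp]; simp
  have h2 : ‖Complex.I * x * unitBandKernel n x‖ ≤ 2 := by
    cases n with
    | zero =>
      rw [I_mul_unitBandKernel_zero]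
      refine (norm_sub_le _ _).trans ?_
      rw [hexp, norm_one]
      norm_num
    | succ n =>
      rw [I_mul_unitBandKernel_succ]
      refine (norm_sub_le _ _).trans ?_
      have := norm_succ_mul_unitBandKernel_le_one n x
      rw [norm_mul, hexp, norm_pow, Complex.norm_I, one_pow, norm_mul Complex.I, Complex.norm_I]
      linarith
  rw [norm_mul, norm_mul, Complex.norm_I, Complex.norm_real, one_mul, Real.norm_eq_abs] at h2
  rw [le_div_iff₀ (by positivity)]
  linarith

theorem unitBandKernel_zero_zero : unitBandKernel 0 0 = 1 := by
  simp [unitBandKernel]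

/-- One kernel decays only like `1 / |x|`; squaring makes the weight integrable, at the price of
type `1 + 1 = 2`. -/
theorem expTypeBound_unitBandKernel_sq :
    ExpTypeBound (fun x => unitBandKernel 0 x * unitBandKernel 0 x) 2
      (fun x => 9 * (1 + x ^ 2)⁻¹) := by
  have h : ExpTypeBound (unitBandKernel 0) 1 (fun x => 3 / (1 + |x|)) :=
    .of_hasDerivAt_succ hasDerivAt_unitBandKernel fun n t => by
      rw [one_pow, one_mul]; exact norm_unitBandKernel_le n t
  have h2 := h.mul h zero_le_one
  rw [one_add_one_eq_two] at h2
  refine h2.mono_weight zero_le_two fun t => ?_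
  rw [div_mul_div_comm, ← div_eq_mul_inv]
  norm_num
  gcongr
  nlinarith [abs_nonneg t, sq_abs t]

/-! ### The scalar sampling formula -/

theorem tendsto_iteratedDeriv_dilate_mul {f p : ℝ → ℂ} (hf : ContDiff ℝ ∞ f) (hp : ContDiff ℝ ∞ p)
    (hp0 : p 0 = 1) (r : ℕ) :
    Tendsto (fun δ : ℝ => iteratedDeriv r (fun t => f ((1 - δ) * t) * p (δ * t)) 0) (𝓝 0)
      (𝓝 (iteratedDeriv r f 0)) := by
  have hf' : ∀ n : ℕ, ContDiff ℝ n f := fun n => contDiff_infty.1 hf n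
  have hp' : ∀ n : ℕ, ContDiff ℝ n p := fun n => contDiff_infty.1 hp n
  have h : ∀ δ : ℝ, iteratedDeriv r (fun t => f ((1 - δ) * t) * p (δ * t)) 0 =
      ∑ i ∈ Finset.range (r + 1), (r.choose i : ℂ) * ((1 - δ) ^ i • iteratedDeriv i f 0) *
        (δ ^ (r - i) • iteratedDeriv (r - i) p 0) := by
    intro δ
    have hfd : ContDiff ℝ r fun t => f ((1 - δ) * t) :=
      (hf' r).comp (contDiff_const.mul contDiff_id)
    have hpd : ContDiff ℝ r fun t => p (δ * t) := (hp' r).comp (contDiff_const.mul contDiff_id)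
    have := iteratedDeriv_mul hfd.contDiffAt hpd.contDiffAt (x := 0)
    refine this.trans (Finset.sum_congr rfl fun i _ => ?_)
    rw [iteratedDeriv_comp_const_smul (hf' i), iteratedDeriv_comp_const_smul (hp' (r - i))]
    simp only [mul_zero]
  -- By Leibniz the derivative is a polynomial in `δ`; its value at `δ = 0` is the claimed limit.
  have h0 := h 0
  simp only [sub_zero, one_mul, zero_mul, hp0, mul_one] at h0
  rw [h0]
  simp_rw [h]
  refine Continuous.tendsto' (by fun_prop) _ _ ?_
  simp

/-- The sampling formula of Boas for a function whose `n`-th derivative is bounded by `C σ ^ n`. -/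
theorem ExpTypeBound.hasSum_boasWeight {f : ℝ → ℂ} {σ C : ℝ} (hσ : 0 < σ)
    (hf : ExpTypeBound f σ fun _ => C) (r : ℕ) :
    HasSum (fun k : ℤ => (boasWeight r σ k : ℂ) * f (boasNode r σ k)) (iteratedDeriv r f 0) := by
  -- Dilating the squared kernel by `σ / 2` turns its type `2` into `σ`.
  let p : ℝ → ℂ := fun t => unitBandKernel 0 (σ / 2 * t) * unitBandKernel 0 (σ / 2 * t)
  let w : ℝ → ℝ := fun t => 9 * (1 + (σ / 2 * t) ^ 2)⁻¹
  have hp : ExpTypeBound p σ w := by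
    have h := expTypeBound_unitBandKernel_sq.comp_mul (σ / 2)
    rwa [abs_of_pos (by positivity), div_mul_cancel₀ _ two_ne_zero] at h
  have hp0 : p 0 = 1 := by simp [p, unitBandKernel_zero_zero]
  have hp1 : ∀ t, ‖p t‖ ≤ 1 := fun t => by
    have := norm_unitBandKernel_le_one 0 (σ / 2 * t)
    rw [norm_mul]
    exact mul_le_one₀ this (norm_nonneg _) this
  have hfC : ∀ t, ‖f t‖ ≤ C := fun t => by simpa using hf.norm_iteratedDeriv_le 0 t
  have hsw : Summable fun k : ℤ => ‖(boasWeight r σ k : ℂ)‖ := by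
    simpa using summable_abs_boasWeight r σ
  have key : ∀ δ ∈ Set.Ioo (0 : ℝ) 1,
      ∑' k : ℤ, (boasWeight r σ k : ℂ) *
        (f ((1 - δ) * boasNode r σ k) * p (δ * boasNode r σ k)) =
      iteratedDeriv r (fun t => f ((1 - δ) * t) * p (δ * t)) 0 := by
    intro δ hδ
    -- The product has type `(1 - δ)σ + δσ = σ`, so the same weights apply for every `δ`.
    have h1 := (hf.comp_mul (1 - δ)).mul (hp.comp_mul δ) (by positivity)
    rw [abs_of_pos (by linarith [hδ.2]), abs_of_pos hδ.1, ← add_mul, sub_add_cancel, one_mul] at h1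
    have hw : MeasureTheory.Integrable fun t => C * w (δ * t) := by
      have h2 := (integrable_inv_one_add_sq.comp_mul_left' (g := fun x : ℝ => (1 + x ^ 2)⁻¹)
        (R := σ / 2 * δ) (by have := hδ.1; positivity)).const_mul (C * 9)
      refine h2.congr (Eventually.of_forall fun t => ?_)
      simp only [w]
      rw [mul_assoc, mul_assoc]
    exact (h1.hasSum_of_hasSum_symbol hw hσ.le r hsw
      fun x hx => hasSum_boasWeight_cexp hσ r hx).tsum_eq
  have hlim : Tendsto (fun δ : ℝ => ∑' k : ℤ, (boasWeight r σ k : ℂ) *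
      (f ((1 - δ) * boasNode r σ k) * p (δ * boasNode r σ k))) (𝓝[>] 0)
      (𝓝 (∑' k : ℤ, (boasWeight r σ k : ℂ) * f (boasNode r σ k))) := by
    refine tendsto_tsum_of_dominated_convergence (hsw.mul_right C) (fun k => ?_)
      (Eventually.of_forall fun δ k => ?_)
    · have hfc := hf.contDiff.continuous
      have hpc := hp.contDiff.continuous
      refine ((Continuous.tendsto' (by fun_prop) (0 : ℝ) _ ?_).mono_left nhdsWithin_le_nhds)
      simp [hp0]
    · rw [norm_mul, norm_mul]
      refine mul_le_mul_of_nonneg_left ?_ (norm_nonneg _)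
      calc _ ≤ C * 1 := mul_le_mul (hfC _) (hp1 _) (norm_nonneg _) ((norm_nonneg _).trans (hfC 0))
        _ = C := mul_one C
  have heq := tendsto_nhds_unique (hlim.congr' (by
    filter_upwards [Ioo_mem_nhdsGT (zero_lt_one' ℝ)] with δ hδ using key δ hδ))
    ((tendsto_iteratedDeriv_dilate_mul hf.contDiff hp.contDiff hp0 r).mono_left nhdsWithin_le_nhds)
  rw [← heq]
  refine (Summable.of_norm_bounded (hsw.mul_right C) fun k => ?_).hasSum
  rw [norm_mul]
  exact mul_le_mul_of_nonneg_left (hfC _) (norm_nonneg _)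

/-! ### Orbits under powers of the generator -/

section Orbits

variable {𝕜 E : Type*} [RCLike 𝕜] [NormedAddCommGroup E] [NormedSpace 𝕜 E]

/-- `v k = D ^ k (v 0)` for all `k`, with `v 0` in the domain of every power of `D`. -/
def IsPowerOrbit (D : E →ₗ.[𝕜] E) (v : ℕ → E) : Prop :=
  ∀ k, (v k, v (k + 1)) ∈ D.graph

namespace IsPowerOrbit

variable {D : E →ₗ.[𝕜] E} {v w : ℕ → E}

theorem opPow_eq (hv : IsPowerOrbit D v) (k : ℕ) :
    ∃ hf : v 0 ∈ (opPow D k).domain, opPow D k ⟨v 0, hf⟩ = v k := by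
  induction k with
  | zero => exact ⟨Submodule.mem_top, rfl⟩
  | succ k ih =>
    obtain ⟨hf, h⟩ := ih
    obtain ⟨⟨y, hy⟩, h1, h2⟩ := (LinearPMap.mem_graph_iff _).1 (hv k)
    simp only at h1 h2
    subst h1
    have hmem : opPow D k ⟨v 0, hf⟩ ∈ D.domain := by rwa [h]
    refine ⟨⟨hf, hmem⟩, ?_⟩
    change D ⟨opPow D k ⟨v 0, hf⟩, hmem⟩ = v (k + 1)
    rw [← h2]
    congr 1
    exact Subtype.ext h

theorem add (hv : IsPowerOrbit D v) (hw : IsPowerOrbit D w) :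
    IsPowerOrbit D fun k => v k + w k :=
  fun k => D.graph.add_mem (hv k) (hw k)

theorem smul (c : 𝕜) (hv : IsPowerOrbit D v) : IsPowerOrbit D fun k => c • v k :=
  fun k => D.graph.smul_mem c (hv k)

theorem shift (hv : IsPowerOrbit D v) (j : ℕ) : IsPowerOrbit D fun k => v (k + j) := fun k => by
  have := hv (k + j)
  rwa [show k + j + 1 = k + 1 + j by ring] at this

end IsPowerOrbit

/-- Trading nested domain conditions for a sequence in the graph makes sums, shifts and limits
straightforward. -/
theorem mem_bernsteinSet_iff (D : E →ₗ.[𝕜] E) (σ : ℝ) (f : E) :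
    f ∈ bernsteinSet D σ ↔
      ∃ v : ℕ → E, v 0 = f ∧ IsPowerOrbit D v ∧ ∀ k, ‖v k‖ ≤ σ ^ k * ‖f‖ := by
  constructor
  · intro h
    choose hf hb using h
    refine ⟨fun k => opPow D k ⟨f, hf k⟩, rfl, fun k => ?_, hb⟩
    obtain ⟨h1, h2⟩ := hf (k + 1)
    exact (LinearPMap.mem_graph_iff _).2 ⟨⟨opPow D k ⟨f, h1⟩, h2⟩, rfl, rfl⟩
  · rintro ⟨v, rfl, hv, hb⟩ k
    obtain ⟨hf, h⟩ := hv.opPow_eq k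
    exact ⟨hf, h ▸ hb k⟩

end Orbits

/-! ### Boas' formula and Bernstein's inequality in the Banach space -/

namespace IsometryGroup

variable {𝕜 E : Type*} [RCLike 𝕜] [NormedAddCommGroup E] [NormedSpace 𝕜 E]

theorem hasDerivAt_op [NormedSpace ℝ E] [IsScalarTower ℝ 𝕜 E] (U : IsometryGroup 𝕜 E) {f g : E}
    (h : (f, g) ∈ U.generator.graph) (x : ℝ) :
    HasDerivAt (fun t => U.op t f) (U.op x g) x := by
  rw [hasDerivAt_iff_tendsto_slope_zero]
  have h1 := ((U.op x).continuous.tendsto g).comp ((U.mem_graph_generator f g).1 h)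
  refine h1.congr fun t => ?_
  simp only [Function.comp_apply]
  rw [map_smul, map_sub, RCLike.real_smul_eq_coe_smul (K := 𝕜), U.op_add]
  rfl

theorem mem_graph_generator_of_hasDerivAt [NormedSpace ℝ E] [IsScalarTower ℝ 𝕜 E]
    (U : IsometryGroup 𝕜 E) {f g : E} (h : HasDerivAt (fun t => U.op t f) g 0) :
    (f, g) ∈ U.generator.graph := by
  rw [U.mem_graph_generator]
  refine (hasDerivAt_iff_tendsto_slope_zero.1 h).congr fun t => ?_
  rw [RCLike.real_smul_eq_coe_smul (K := 𝕜), U.op_zero, zero_add]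
  rfl

/-- Since the group is isometric, convergence of `D f_n` makes the derivatives of the orbits
converge uniformly in `t`, so the limit may be differentiated. -/
theorem isClosed_graph_generator (U : IsometryGroup 𝕜 E) :
    IsClosed (U.generator.graph : Set (E × E)) := by
  let _ : NormedSpace ℝ E := NormedSpace.restrictScalars ℝ 𝕜 E
  have : IsScalarTower ℝ 𝕜 E := RestrictScalars.isScalarTower ℝ 𝕜 E
  refine IsSeqClosed.isClosed fun p q hp hq => ?_
  have hf : Tendsto (fun n => (p n).1) atTop (𝓝 q.1) := (continuous_fst.tendsto q).comp hq
  have hg : Tendsto (fun n => (p n).2) atTop (𝓝 q.2) := (continuous_snd.tendsto q).comp hq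
  have hder : HasDerivAt (fun t => U.op t q.1) (U.op 0 q.2) 0 := by
    refine hasDerivAt_of_tendstoUniformly (l := atTop) (f := fun n t => U.op t (p n).1)
      (f' := fun n t => U.op t (p n).2) (g' := fun t => U.op t q.2) ?_
      (Eventually.of_forall fun n x => U.hasDerivAt_op (hp n) x)
      (fun x => ((U.op x).continuous.tendsto _).comp hf) 0
    rw [Metric.tendstoUniformly_iff]
    intro ε hε
    filter_upwards [Metric.tendsto_nhds.1 hg ε hε] with n hn x
    rwa [dist_comm, dist_eq_norm, ← map_sub, U.norm_op, ← dist_eq_norm]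
  rw [U.op_zero] at hder
  exact U.mem_graph_generator_of_hasDerivAt hder

variable [CompleteSpace E]

/-- A functional norming the difference of the two sides reduces this to the scalar formula along
the orbit. The constant `C` is left free so that the result applies to sums and shifted orbits. -/
theorem eq_boasOp_of_norm_le (U : IsometryGroup 𝕜 E) {v : ℕ → E}
    (hv : IsPowerOrbit U.generator v) {σ C : ℝ} (hσ : 0 < σ) (hb : ∀ k, ‖v k‖ ≤ C * σ ^ k)
    (r : ℕ) : v r = U.boasOp r σ (v 0) := by
  let _ : NormedSpace ℝ E := NormedSpace.restrictScalars ℝ 𝕜 E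
  have : IsScalarTower ℝ 𝕜 E := RestrictScalars.isScalarTower ℝ 𝕜 E
  obtain ⟨φ, hφ1, hφ⟩ := exists_dual_vector'' 𝕜 (v r - U.boasOp r σ (v 0))
  -- Taking the real part treats both scalar fields at once and loses nothing, because `φ` of the
  -- difference is its norm.
  let L : E →L[ℝ] ℂ :=
    Complex.ofRealCLM.comp ((RCLike.reCLM (K := 𝕜)).comp (φ.restrictScalars ℝ))
  have hL : ∀ x, L x = ((RCLike.re (φ x) : ℝ) : ℂ) := fun x => rfl
  have hLnorm : ∀ x, ‖L x‖ ≤ ‖x‖ := fun x => by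
    rw [hL, Complex.norm_real]
    refine (RCLike.norm_re_le_norm _).trans ((φ.le_opNorm x).trans ?_)
    exact mul_le_of_le_one_left (norm_nonneg _) hφ1
  have hF : ∀ n t, HasDerivAt (fun t => L (U.op t (v n))) (L (U.op t (v (n + 1)))) t :=
    fun n t => L.hasFDerivAt.comp_hasDerivAt t (U.hasDerivAt_op (hv n) t)
  have hbound : ExpTypeBound (fun t => L (U.op t (v 0))) σ fun _ => C :=
    ExpTypeBound.of_hasDerivAt_succ (F := fun n t => L (U.op t (v n))) hF fun n t => by
      refine (hLnorm _).trans ?_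
      rw [U.norm_op, mul_comm]
      exact hb n
  have h1 := hbound.hasSum_boasWeight hσ r
  rw [iteratedDeriv_of_hasDerivAt_succ (F := fun n t => L (U.op t (v n))) hF r] at h1
  have h2 := (U.hasSum_boasOp r σ (v 0)).mapL L
  have h3 : ∀ k : ℤ, L (((boasWeight r σ k : ℝ) : 𝕜) • U.op (boasNode r σ k) (v 0)) =
      (boasWeight r σ k : ℂ) * L (U.op (boasNode r σ k) (v 0)) := fun k => by
    rw [← RCLike.real_smul_eq_coe_smul (K := 𝕜), map_smul, Complex.real_smul]
  simp only [h3] at h2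
  have h4 : L (U.op 0 (v r)) = L (U.boasOp r σ (v 0)) := h1.unique h2
  rw [U.op_zero, ContinuousLinearMap.id_apply, ← sub_eq_zero, ← map_sub, hL, hφ,
    RCLike.ofReal_re, Complex.ofReal_eq_zero, norm_eq_zero, sub_eq_zero] at h4
  exact h4

theorem norm_boasOp_one_le (U : IsometryGroup 𝕜 E) {σ : ℝ} (hσ : 0 < σ) (f : E) :
    ‖U.boasOp 1 σ f‖ ≤ σ * ‖f‖ := by
  refine (U.hasSum_boasOp 1 σ f).norm_le_of_bounded
    ((hasSum_abs_boasWeight_one hσ).mul_right ‖f‖) fun k => (U.norm_boasTerm 1 σ f k).le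

/-- Bernstein's inequality. -/
theorem norm_le_pow_mul_of_norm_le (U : IsometryGroup 𝕜 E) {v : ℕ → E}
    (hv : IsPowerOrbit U.generator v) {σ C : ℝ} (hσ : 0 ≤ σ) (hb : ∀ k, ‖v k‖ ≤ C * σ ^ k)
    (k : ℕ) : ‖v k‖ ≤ σ ^ k * ‖v 0‖ := by
  rcases hσ.eq_or_lt with rfl | hσ
  · rcases k with _ | k
    · simp
    · simpa using hb (k + 1)
  · induction k with
    | zero => simp
    | succ k ih =>
      -- The shifted orbit starts at `v k`, so order one gives `v (k + 1) = 𝓑^{(1)}(σ) (v k)`, and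
      -- each step costs a factor `σ`.
      have h := U.eq_boasOp_of_norm_le (hv.shift k) (C := C * σ ^ k) hσ
        (fun j => (hb (j + k)).trans_eq (by ring)) 1
      rw [add_comm k 1, h, pow_add, pow_one, mul_assoc]
      refine (U.norm_boasOp_one_le hσ _).trans ?_
      rw [zero_add]
      exact mul_le_mul_of_nonneg_left ih hσ.le

/-- This gives additivity: for a sum one only gets the constant `‖v 0‖ + ‖w 0‖`, which Bernstein's
inequality sharpens to the norm of the sum. -/
theorem mem_bernsteinSet_of_norm_le (U : IsometryGroup 𝕜 E) {v : ℕ → E}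
    (hv : IsPowerOrbit U.generator v) {σ C : ℝ} (hσ : 0 ≤ σ) (hb : ∀ k, ‖v k‖ ≤ C * σ ^ k) :
    v 0 ∈ bernsteinSet U.generator σ :=
  (mem_bernsteinSet_iff _ _ _).2 ⟨v, rfl, hv, U.norm_le_pow_mul_of_norm_le hv hσ hb⟩

/-- The Bernstein set as a linear subspace. -/
def bernsteinSubmodule (U : IsometryGroup 𝕜 E) {σ : ℝ} (hσ : 0 ≤ σ) : Submodule 𝕜 E where
  carrier := bernsteinSet U.generator σ
  add_mem' := by
    intro f g hf hg
    obtain ⟨v, rfl, hv, hvb⟩ := (mem_bernsteinSet_iff _ _ _).1 hf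
    obtain ⟨w, rfl, hw, hwb⟩ := (mem_bernsteinSet_iff _ _ _).1 hg
    refine U.mem_bernsteinSet_of_norm_le (hv.add hw) (C := ‖v 0‖ + ‖w 0‖) hσ fun k => ?_
    exact (norm_add_le _ _).trans ((add_le_add (hvb k) (hwb k)).trans_eq (by ring))
  zero_mem' := by
    refine U.mem_bernsteinSet_of_norm_le (v := fun _ => 0) (C := 0) ?_ hσ (by simp)
    exact fun k => U.generator.graph.zero_mem
  smul_mem' := by
    intro c f hf
    obtain ⟨v, rfl, hv, hvb⟩ := (mem_bernsteinSet_iff _ _ _).1 hf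
    refine U.mem_bernsteinSet_of_norm_le (hv.smul c) (C := ‖c‖ * ‖v 0‖) hσ fun k => ?_
    rw [norm_smul]
    exact (mul_le_mul_of_nonneg_left (hvb k) (norm_nonneg c)).trans_eq (by ring)

/-- On Bernstein vectors the powers of `D` agree with bounded operators independent of the vector,
so they pass to limits. For `σ = 0` all positive powers vanish. -/
theorem exists_clm_eq_of_norm_le (U : IsometryGroup 𝕜 E) {σ : ℝ} (hσ : 0 ≤ σ) :
    ∃ T : ℕ → E →L[𝕜] E, ∀ v : ℕ → E, IsPowerOrbit U.generator v →
      (∀ k, ‖v k‖ ≤ σ ^ k * ‖v 0‖) → ∀ k, v k = T k (v 0) := by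
  rcases hσ.eq_or_lt with rfl | hσ
  · refine ⟨fun k => if k = 0 then ContinuousLinearMap.id 𝕜 E else 0, fun v _ hb k => ?_⟩
    rcases k with _ | k
    · simp
    · simpa using hb (k + 1)
  · exact ⟨fun k => U.boasOp k σ, fun v hv hb k =>
      U.eq_boasOp_of_norm_le hv hσ (fun j => (hb j).trans_eq (mul_comm _ _)) k⟩

theorem isClosed_bernsteinSet (U : IsometryGroup 𝕜 E) {σ : ℝ} (hσ : 0 ≤ σ) :
    IsClosed (bernsteinSet U.generator σ) := by
  obtain ⟨T, hT⟩ := U.exists_clm_eq_of_norm_le hσ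
  refine IsSeqClosed.isClosed fun p f hp hpf => ?_
  have hTlim : ∀ k, Tendsto (fun n => T k (p n)) atTop (𝓝 (T k f)) :=
    fun k => ((T k).continuous.tendsto f).comp hpf
  have horb : ∀ n, T 0 (p n) = p n ∧ (∀ k, (T k (p n), T (k + 1) (p n)) ∈ U.generator.graph) ∧
      ∀ k, ‖T k (p n)‖ ≤ σ ^ k * ‖p n‖ := by
    intro n
    obtain ⟨v, h0, hv, hb⟩ := (mem_bernsteinSet_iff _ _ _).1 (hp n)
    rw [← h0] at hb ⊢
    have h := hT v hv hb
    refine ⟨(h 0).symm, fun k => ?_, fun k => ?_⟩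
    · rw [← h k, ← h (k + 1)]; exact hv k
    · rw [← h k]; exact hb k
  refine (mem_bernsteinSet_iff _ _ _).2 ⟨fun k => T k f, ?_, fun k => ?_, fun k => ?_⟩
  · exact tendsto_nhds_unique (hTlim 0) (by simpa only [(horb _).1] using hpf)
  · exact U.isClosed_graph_generator.mem_of_tendsto ((hTlim k).prodMk_nhds (hTlim (k + 1)))
      (Eventually.of_forall fun n => (horb n).2.1 k)
  · exact le_of_tendsto_of_tendsto' (hTlim k).norm (hpf.norm.const_mul _) fun n => (horb n).2.2 k

end IsometryGroup

theorem mainTheorem6 {𝕜 E : Type*} [RCLike 𝕜] [NormedAddCommGroup E] [NormedSpace 𝕜 E]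
    [CompleteSpace E] (U : IsometryGroup 𝕜 E) :
    (∀ σ : ℝ, 0 ≤ σ →
      ∃ S : Submodule 𝕜 E,
        (S : Set E) = bernsteinSet U.generator σ ∧ IsClosed (S : Set E)) ∧
    (∀ σ : ℝ, 0 ≤ σ → ∀ f ∈ bernsteinSet U.generator σ,
      ∀ σ₁ σ₂ : ℝ, 0 < σ₁ → 0 < σ₂ → σ ≤ σ₁ → σ ≤ σ₂ →
        ∀ r : ℕ, 1 ≤ r → U.boasOp r σ₁ f = U.boasOp r σ₂ f) ∧
    (∀ σ : ℝ, 0 < σ → ∀ f ∈ bernsteinSet U.generator σ, ∀ r : ℕ, 1 ≤ r →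
      ∃ hf : f ∈ (opPow U.generator r).domain,
        opPow U.generator r ⟨f, hf⟩ = U.boasOp r σ f ∧
        U.boasOp r σ f = (U.boasOp 1 σ ^ r) f) := by
  refine ⟨fun σ hσ => ⟨U.bernsteinSubmodule hσ, rfl, U.isClosed_bernsteinSet hσ⟩, ?_, ?_⟩
  · intro σ hσ f hf σ₁ σ₂ h₁ h₂ hle₁ hle₂ r _
    obtain ⟨v, rfl, hv, hb⟩ := (mem_bernsteinSet_iff _ _ _).1 hf
    -- Both operators compute the same vector `v r`, since a bound with `σ^k` implies one with
    -- `τ^k`.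
    have key : ∀ τ : ℝ, 0 < τ → σ ≤ τ → v r = U.boasOp r τ (v 0) := fun τ hτ hστ =>
      U.eq_boasOp_of_norm_le hv (C := ‖v 0‖) hτ (fun k => (hb k).trans (by
        rw [mul_comm]; gcongr)) r
    rw [← key σ₁ h₁ hle₁, ← key σ₂ h₂ hle₂]
  · intro σ hσ f hf r _
    obtain ⟨v, rfl, hv, hb⟩ := (mem_bernsteinSet_iff _ _ _).1 hf
    have hb' : ∀ k, ‖v k‖ ≤ ‖v 0‖ * σ ^ k := fun k => (hb k).trans_eq (mul_comm _ _)
    have hiter : ∀ j, v j = (U.boasOp 1 σ ^ j) (v 0) := by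
      intro j
      induction j with
      | zero => simp
      | succ j ih =>
        have h := U.eq_boasOp_of_norm_le (hv.shift j) (C := ‖v 0‖ * σ ^ j) hσ
          (fun i => (hb' (i + j)).trans_eq (by ring)) 1
        rw [zero_add, add_comm 1 j] at h
        rw [h, ih, pow_succ']
        rfl
    obtain ⟨hdom, h⟩ := hv.opPow_eq r
    have hr := U.eq_boasOp_of_norm_le hv hσ hb' r
    exact ⟨hdom, h.trans hr, hr ▸ hiter r⟩
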